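/- For a finite group $G$, let $\operatorname{RO}(G)$ be the group of formal differences $U-V$ of finite-dimensional $\mathbb{R}G$-modules, where $U-V=U'-V'$ if $U\oplus V'\oplus W\cong U'\oplus V\oplus W$ for some $\mathbb{R}G$-module $W$, with addition induced by direct sum. Call $U$ and $V$ $\mathcal{P}$-matched if $\operatorname{Res}^G_P U\cong\operatorname{Res}^G_P V$ for every subgroup $P\le G$ of prime power order, and let $\operatorname{PO}(G)\le\operatorname{RO}(G)$ be the subgroup of all elements $U-V$ with $U,V$ $\mathcal{P}$-matched. For $H\le G$ let $\operatorname{Ind}_H^G\colon\operatorname{RO}(H)\to\operatorname{RO}(G)$ be the homomorphism $U-V\mapsto\operatorname{Ind}_H^G U-\operatorname{Ind}_H^G V$. Let $p$ and $q$ be odd primes with $q\mid p-1$, let $v$ be a primitive root modulo $p$ with $q\nmid v$, and let $i$ be the residue of $v^{(p-1)(q-1)/q}$ modulo $pq$. Let $D_{2pq}=\langle a,b\mid a^{pq}=b^2=1,\ bab=a^{-1}\rangle$, $C_q=\langle c\mid c^q=1\rangle$, and let $G_{p,q}=D_{2pq}\rtimes C_q$, where $c$ acts on $D_{2pq}$ by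 the automorphism $a\mapsto a^i$, $b\mapsto b$. Corollary. The group $G_{p,q}$ has a unique subgroup $N_{pq^2}$ of index $2$, the homomorphism $\operatorname{Ind}_{N_{pq^2}}^{G_{p,q}}$ maps $\operatorname{PO}(N_{pq^2})$ into $\operatorname{PO}(G_{p,q})$, and the resulting homomorphism $$\operatorname{Ind}_{N_{pq^2}}^{G_{p,q}}\colon\operatorname{PO}(N_{pq^2})\to\operatorname{PO}(G_{p,q})$$ is a monomorphism. -/

import Mathlib

namespace DihedralGroup

/-- Multiplication by a unit `u` of `ℤ/n` as an automorphism of the dihedral group of order `2n`.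
With `a = r 1` and `b = sr 0` it is determined by `a ↦ a ^ u`, `b ↦ b`. -/
def scale {n : ℕ} (u : (ZMod n)ˣ) : MulAut (DihedralGroup n) where
  toFun
    | r k => r (u * k)
    | sr k => sr (u * k)
  invFun
    | r k => r ((u⁻¹ : (ZMod n)ˣ) * k)
    | sr k => sr ((u⁻¹ : (ZMod n)ˣ) * k)
  left_inv := by rintro (k | k) <;> simp
  right_inv := by rintro (k | k) <;> simp
  map_mul' := by rintro (k | k) (l | l) <;> simp [mul_add, mul_sub]

/-- `scale` as a homomorphism `(ℤ/n)ˣ → Aut D_{2n}`. -/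
def scaleHom (n : ℕ) : (ZMod n)ˣ →* MulAut (DihedralGroup n) where
  toFun := scale
  map_one' := by ext (k | k) <;> simp [scale]
  map_mul' u w := by ext (k | k) <;> simp [scale, mul_assoc]

end DihedralGroup

/-- The homomorphism from the cyclic group `C_q = ⟨c⟩`, `c = ofAdd 1`, to `M` sending `c` to `m`,
for an element `m` of `M` with `m ^ q = 1`. -/
def cyclicHom {M : Type*} [Group M] (q : ℕ) (m : M) (hm : m ^ q = 1) :
    Multiplicative (ZMod q) →* M :=
  AddMonoidHom.toMultiplicativeLeft
    (ZMod.lift q ⟨zmultiplesHom (Additive M) (Additive.ofMul m), by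
      simp [← ofMul_pow, hm]⟩)

theorem cyclicHom_generator {M : Type*} [Group M] (q : ℕ) (m : M) (hm : m ^ q = 1) :
    cyclicHom q m hm (Multiplicative.ofAdd 1) = m := by
  have h := ZMod.lift_coe q ⟨zmultiplesHom (Additive M) (Additive.ofMul m), by
      simp [← ofMul_pow, hm]⟩ 1
  simp only [Int.cast_one] at h
  simp [cyclicHom, h]

theorem coprime_of_primitiveRoot {p q v : ℕ} [Fact p.Prime] [Fact q.Prime]
    (hv : IsPrimitiveRoot (v : ZMod p) (p - 1)) (hqv : ¬ q ∣ v) : Nat.Coprime v (p * q) := by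
  have h0 : p - 1 ≠ 0 := by
    have := (Fact.out : p.Prime).two_le
    omega
  exact Nat.Coprime.mul_right ((ZMod.isUnit_iff_coprime v p).1 (hv.isUnit h0))
    (((Fact.out : q.Prime).coprime_iff_not_dvd.2 hqv).symm)

/-- The residue class `i = v ^ ((p - 1)(q - 1) / q)` modulo `pq`, as a unit, where `v` is a primitive
root modulo `p` that is not divisible by `q`. -/
def twistUnit (p q v : ℕ) [Fact p.Prime] [Fact q.Prime]
    (hv : IsPrimitiveRoot (v : ZMod p) (p - 1)) (hqv : ¬ q ∣ v) : (ZMod (p * q))ˣ :=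
  ZMod.unitOfCoprime v (coprime_of_primitiveRoot hv hqv) ^ ((p - 1) * (q - 1) / q)

theorem twistUnit_pow (p q v : ℕ) [Fact p.Prime] [Fact q.Prime] (hqp : q ∣ p - 1)
    (hv : IsPrimitiveRoot (v : ZMod p) (p - 1)) (hqv : ¬ q ∣ v) :
    twistUnit p q v hv hqv ^ q = 1 := by
  have hne : p ≠ q := by
    rintro rfl
    have h2 := (Fact.out : p.Prime).two_le
    have := Nat.le_of_dvd (by omega) hqp
    omega
  have hpq : Nat.Coprime p q :=
    (Nat.coprime_primes (Fact.out : p.Prime) (Fact.out : q.Prime)).2 hne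
  rw [twistUnit, ← pow_mul, Nat.div_mul_cancel (hqp.mul_right _),
    ← Nat.totient_prime (Fact.out : p.Prime), ← Nat.totient_prime (Fact.out : q.Prime),
    ← Nat.totient_mul hpq, ZMod.pow_totient]

/-- The semidirect product `G_{p,q} = D_{2pq} ⋊ C_q`, in which the generator `c` of `C_q` acts by
`a ↦ a ^ i`, `b ↦ b` with `i = v ^ ((p - 1)(q - 1) / q)` modulo `pq`. -/
abbrev GroupPQ (p q v : ℕ) [Fact p.Prime] [Fact q.Prime] (hqp : q ∣ p - 1)
    (hv : IsPrimitiveRoot (v : ZMod p) (p - 1)) (hqv : ¬ q ∣ v) : Type :=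
  DihedralGroup (p * q) ⋊[cyclicHom q (DihedralGroup.scaleHom (p * q) (twistUnit p q v hv hqv))
    (by rw [← map_pow, twistUnit_pow p q v hqp hv hqv, map_one])] Multiplicative (ZMod q)

instance SemidirectProduct.instFiniteOfFactors {N K : Type*} [Group N] [Group K]
    (φ : K →* MulAut N) [Finite N] [Finite K] : Finite (N ⋊[φ] K) :=
  Finite.of_equiv _ SemidirectProduct.equivProd.symm


noncomputable section

/-- A finite-dimensional real `G`-module. -/
structure RealRep (G : Type) [Group G] : Type 1 where
  carrier : Type
  [addCommGroup : AddCommGroup carrier]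
  [module : Module ℝ carrier]
  [finite : Module.Finite ℝ carrier]
  ρ : Representation ℝ G carrier

attribute [instance] RealRep.addCommGroup RealRep.module RealRep.finite

namespace RealRep

variable {G : Type} [Group G]

/-- Isomorphism of real `G`-modules. -/
def Iso (U V : RealRep G) : Prop := Nonempty (U.ρ.Equiv V.ρ)

/-- Direct sum of real `G`-modules. -/
def sum (U V : RealRep G) : RealRep G := ⟨U.carrier × V.carrier, U.ρ.prod V.ρ⟩

/-- The zero module. -/
def zero (G : Type) [Group G] : RealRep G := ⟨PUnit, Representation.trivial ℝ G PUnit⟩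

/-- Restriction to a subgroup. -/
def res (P : Subgroup G) (U : RealRep G) : RealRep P := ⟨U.carrier, U.ρ.comp P.subtype⟩

instance setoid (G : Type) [Group G] : Setoid (RealRep G) where
  r := Iso
  iseqv := ⟨fun U => ⟨.refl U.ρ⟩, fun ⟨e⟩ => ⟨e.symm⟩, fun ⟨e⟩ ⟨f⟩ => ⟨e.trans f⟩⟩

theorem sum_congr {U U' V V' : RealRep G} (h : Iso U U') (h' : Iso V V') :
    Iso (sum U V) (sum U' V') := by
  obtain ⟨e⟩ := h
  obtain ⟨f⟩ := h'
  refine ⟨.mk (e.toLinearEquiv.prodCongr f.toLinearEquiv) fun g => ?_⟩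
  apply LinearMap.ext
  rintro ⟨x, y⟩
  exact Prod.ext (LinearMap.congr_fun (e.isIntertwining' g) x)
    (LinearMap.congr_fun (f.isIntertwining' g) y)

theorem sum_comm (U V : RealRep G) : Iso (sum U V) (sum V U) :=
  ⟨.mk (LinearEquiv.prodComm ℝ U.carrier V.carrier) fun _ => rfl⟩

theorem sum_assoc (U V W : RealRep G) : Iso (sum (sum U V) W) (sum U (sum V W)) :=
  ⟨.mk (LinearEquiv.prodAssoc ℝ U.carrier V.carrier W.carrier) fun _ => rfl⟩

theorem zero_sum (U : RealRep G) : Iso (sum (zero G) U) U :=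
  ⟨.mk (LinearEquiv.uniqueProd (R := ℝ) (M := U.carrier) (M₂ := PUnit)) fun _ => rfl⟩

end RealRep

/-- Isomorphism classes of real `G`-modules. -/
def RepClass (G : Type) [Group G] : Type 1 := Quotient (RealRep.setoid G)

namespace RepClass

variable {G : Type} [Group G]

instance : Zero (RepClass G) := ⟨Quotient.mk _ (RealRep.zero G)⟩

/-- Addition of isomorphism classes is induced by direct sum. -/
instance : Add (RepClass G) :=
  ⟨Quotient.map₂ RealRep.sum fun _ _ h _ _ h' => RealRep.sum_congr h h'⟩

protected theorem zero_add' (x : RepClass G) : 0 + x = x := by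
  obtain ⟨U⟩ := x
  exact Quotient.sound (RealRep.zero_sum U)

protected theorem add_comm' (x y : RepClass G) : x + y = y + x := by
  obtain ⟨U⟩ := x
  obtain ⟨V⟩ := y
  exact Quotient.sound (RealRep.sum_comm U V)

instance : AddCommMonoid (RepClass G) where
  add_assoc := by
    rintro ⟨U⟩ ⟨V⟩ ⟨W⟩
    exact Quotient.sound (RealRep.sum_assoc U V W)
  add_comm := RepClass.add_comm'
  zero_add := RepClass.zero_add'
  add_zero x := (RepClass.add_comm' x 0).trans (RepClass.zero_add' x)
  nsmul := nsmulRec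

/-- The isomorphism class of a real `G`-module. -/
def mk (U : RealRep G) : RepClass G := Quotient.mk _ U

end RepClass

/-- The real representation group `RO(G)`: formal differences of real `G`-modules, with `U - V` and
`U' - V'` identified when `U ⊕ V' ⊕ W ≅ U' ⊕ V ⊕ W` for some `W`. -/
abbrev RO (G : Type) [Group G] : Type 1 := Algebra.GrothendieckAddGroup (RepClass G)

namespace RealRep

variable {G : Type} [Group G]

/-- The class of a real `G`-module in `RO(G)`. -/
def cls (U : RealRep G) : RO G :=
  Algebra.GrothendieckAddGroup.of (RepClass.mk U)

theorem cls_sum (U V : RealRep G) : cls (sum U V) = cls U + cls V :=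
  map_add Algebra.GrothendieckAddGroup.of
    (RepClass.mk U) (RepClass.mk V)

/-- `U` and `V` are `𝒫`-matched: their restrictions to each subgroup of prime power order are
isomorphic. -/
def PMatched (U V : RealRep G) : Prop :=
  ∀ P : Subgroup G, (∃ l k : ℕ, l.Prime ∧ Nat.card P = l ^ k) → Iso (res P U) (res P V)

theorem PMatched.symm {U V : RealRep G} (h : PMatched U V) : PMatched V U := fun P hP =>
  (setoid P).symm (h P hP)

theorem PMatched.sum {U V U' V' : RealRep G} (h : PMatched U V) (h' : PMatched U' V') :
    PMatched (sum U U') (RealRep.sum V V') := fun P hP => sum_congr (h P hP) (h' P hP)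

end RealRep

/-- The subgroup `PO(G)` of `RO(G)` of all `U - V` with `U` and `V` `𝒫`-matched. -/
def PO (G : Type) [Group G] : AddSubgroup (RO G) where
  carrier := {x | ∃ U V : RealRep G, U.PMatched V ∧ x = U.cls - V.cls}
  zero_mem' := ⟨RealRep.zero G, RealRep.zero G, fun P _ => (RealRep.setoid P).refl _, by simp⟩
  add_mem' := by
    rintro _ _ ⟨U, V, h, rfl⟩ ⟨U', V', h', rfl⟩
    exact ⟨U.sum U', V.sum V', h.sum h', by rw [RealRep.cls_sum, RealRep.cls_sum]; abel⟩
  neg_mem' := by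
    rintro _ ⟨U, V, h, rfl⟩
    exact ⟨V, U, h.symm, by abel⟩

namespace Representation

variable {G K A B : Type} [Group G] [Group K] (φ : G →* K)
  [AddCommGroup A] [Module ℝ A] [AddCommGroup B] [Module ℝ B]
  {ρ : Representation ℝ G A} {σ : Representation ℝ G B}

/-- The map of induced modules given by a `G`-equivariant linear map. -/
def indLinearMap (f : ρ.IntertwiningMap σ) : IndV φ ρ →ₗ[ℝ] IndV φ σ :=
  Coinvariants.map _ _ ⟨f.toLinearMap.lTensor _, by
    simp [LinearMap.lTensor_comp_map, f.2, LinearMap.map_comp_lTensor]⟩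

theorem indLinearMap_mk (f : ρ.IntertwiningMap σ) (h : K) (a : A) :
    indLinearMap φ f (IndV.mk φ ρ h a) = IndV.mk φ σ h (f a) := by
  simp [indLinearMap]

theorem indLinearMap_ext {f : IndV φ ρ →ₗ[ℝ] IndV φ σ} {g : ρ.IntertwiningMap σ}
    (h : ∀ (k : K) (a : A), f (IndV.mk φ ρ k a) = IndV.mk φ σ k (g a)) :
    f = indLinearMap φ g :=
  IndV.hom_ext _ _ fun k => LinearMap.ext fun a => (h k a).trans (indLinearMap_mk φ g k a).symm

theorem indLinearMap_id : indLinearMap φ (.id ρ) = LinearMap.id :=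
  (indLinearMap_ext φ fun _ _ => rfl).symm

theorem indLinearMap_zero : indLinearMap φ (0 : ρ.IntertwiningMap σ) = 0 :=
  (indLinearMap_ext φ fun _ _ => (map_zero _).symm).symm

theorem indLinearMap_add (f g : ρ.IntertwiningMap σ) :
    indLinearMap φ (f + g) = indLinearMap φ f + indLinearMap φ g := by
  refine (indLinearMap_ext φ fun k a => ?_).symm
  exact (congrArg₂ (· + ·) (indLinearMap_mk φ f k a) (indLinearMap_mk φ g k a)).trans
    (map_add (IndV.mk φ σ k) _ _).symm

theorem indLinearMap_comp {C : Type} [AddCommGroup C] [Module ℝ C] {τ : Representation ℝ G C}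
    (f : σ.IntertwiningMap τ) (g : ρ.IntertwiningMap σ) :
    indLinearMap φ (f.comp g) = indLinearMap φ f ∘ₗ indLinearMap φ g := by
  refine (indLinearMap_ext φ fun k a => ?_).symm
  exact (congrArg _ (indLinearMap_mk φ g k a)).trans (indLinearMap_mk φ f k (g a))

theorem indLinearMap_ind (f : ρ.IntertwiningMap σ) (k : K) :
    indLinearMap φ f ∘ₗ ind φ ρ k = ind φ σ k ∘ₗ indLinearMap φ f := by
  refine IndV.hom_ext _ _ fun h => LinearMap.ext fun a => ?_
  exact ((congrArg _ (ind_mk φ ρ k h a)).trans (indLinearMap_mk φ f _ a)).trans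
    ((congrArg _ (indLinearMap_mk φ f h a)).trans (ind_mk φ σ k h (f a))).symm

/-- An isomorphism of representations induces one of induced representations. -/
def indEquiv (e : ρ.Equiv σ) : (ind φ ρ).Equiv (ind φ σ) :=
  .mk (.ofLinearMap (indLinearMap φ e.toIntertwiningMap) (indLinearMap φ e.symm.toIntertwiningMap)
    (by
      rw [← indLinearMap_comp, ← indLinearMap_id]
      congr 1
      exact IntertwiningMap.ext (LinearMap.ext fun x => e.toLinearEquiv.apply_symm_apply x))
    (by
      rw [← indLinearMap_comp, ← indLinearMap_id]
      congr 1
      exact IntertwiningMap.ext (LinearMap.ext fun x => e.toLinearEquiv.symm_apply_apply x)))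
    fun g => indLinearMap_ind φ e.toIntertwiningMap g

/-- Induction commutes with direct sums. -/
def indProdEquiv (ρ : Representation ℝ G A) (σ : Representation ℝ G B) :
    (ind φ (ρ.prod σ)).Equiv ((ind φ ρ).prod (ind φ σ)) :=
  .mk (.ofLinearMap
    ((indLinearMap φ (IntertwiningMap.fst ℝ ρ σ)).prod
      (indLinearMap φ (IntertwiningMap.snd ℝ ρ σ)))
    ((indLinearMap φ (IntertwiningMap.inl ℝ ρ σ)).coprod
      (indLinearMap φ (IntertwiningMap.inr ℝ ρ σ)))
    (by
      ext1
      · rw [LinearMap.comp_assoc, LinearMap.coprod_inl, LinearMap.prod_comp, ← indLinearMap_comp,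
          ← indLinearMap_comp, IntertwiningMap.fst_comp_inl, IntertwiningMap.snd_comp_inl,
          indLinearMap_id, indLinearMap_zero]
        rfl
      · rw [LinearMap.comp_assoc, LinearMap.coprod_inr, LinearMap.prod_comp, ← indLinearMap_comp,
          ← indLinearMap_comp, IntertwiningMap.fst_comp_inr, IntertwiningMap.snd_comp_inr,
          indLinearMap_id, indLinearMap_zero]
        rfl)
    (by
      rw [LinearMap.coprod_comp_prod, ← indLinearMap_comp, ← indLinearMap_comp,
        ← indLinearMap_add, IntertwiningMap.coprod_inl_inr, indLinearMap_id]))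
    fun g => LinearMap.ext fun x => Prod.ext
      (LinearMap.congr_fun (indLinearMap_ind φ (IntertwiningMap.fst ℝ ρ σ) g) x)
      (LinearMap.congr_fun (indLinearMap_ind φ (IntertwiningMap.snd ℝ ρ σ) g) x)

end Representation

namespace RealRep

open Representation

variable {G : Type} [Group G] [Finite G] (H : Subgroup G)

/-- The induced module `Ind_H^G U`. -/
def ind (U : RealRep H) : RealRep G := ⟨IndV H.subtype U.ρ, U.ρ.ind H.subtype⟩

theorem ind_congr {U V : RealRep H} (h : Iso U V) : Iso (ind H U) (ind H V) :=
  h.map (indEquiv H.subtype)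

theorem ind_sum (U V : RealRep H) : Iso (ind H (sum U V)) (sum (ind H U) (ind H V)) :=
  ⟨indProdEquiv H.subtype U.ρ V.ρ⟩

theorem ind_zero : Iso (ind H (zero H)) (zero G) := by
  have hid : (LinearMap.id : IndV H.subtype (zero H).ρ →ₗ[ℝ] _) = 0 :=
    IndV.hom_ext _ _ fun h => LinearMap.ext fun a => by
      rw [show a = 0 from Subsingleton.elim (α := PUnit) a 0]
      simp only [map_zero]
  have hs : ∀ x : IndV H.subtype (zero H).ρ, x = 0 := fun x => LinearMap.congr_fun hid x
  refine ⟨.mk (.ofLinearMap 0 0 ?_ ?_) fun g => ?_⟩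
  · exact LinearMap.ext fun _ => Subsingleton.elim (α := PUnit) _ _
  · exact LinearMap.ext fun x => (hs x).symm
  · exact LinearMap.ext fun _ => Subsingleton.elim (α := PUnit) _ _

/-- Induction on isomorphism classes. -/
def indClass : RepClass H →+ RepClass G where
  toFun := Quotient.map (ind H) fun _ _ h => ind_congr H h
  map_zero' := Quotient.sound (ind_zero H)
  map_add' := by
    rintro ⟨U⟩ ⟨V⟩
    exact Quotient.sound (ind_sum H U V)

end RealRep

/-- The induction homomorphism `Ind_H^G : RO(H) → RO(G)`, `U - V ↦ Ind_H^G U - Ind_H^G V`. -/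
def indRO {G : Type} [Group G] [Finite G] (H : Subgroup G) : RO H →+ RO G :=
  Algebra.GrothendieckAddGroup.lift
    (Algebra.GrothendieckAddGroup.of.comp (RealRep.indClass H))

theorem indRO_cls {G : Type} [Group G] [Finite G] (H : Subgroup G) (U V : RealRep H) :
    indRO H (U.cls - V.cls) = (U.ind H).cls - (V.ind H).cls := by
  have key : ∀ W : RealRep H, indRO H W.cls = (W.ind H).cls := fun W =>
    DFunLike.congr_fun (Algebra.GrothendieckAddGroup.lift.symm_apply_apply
      (Algebra.GrothendieckAddGroup.of.comp (RealRep.indClass H))) (RepClass.mk W)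
  rw [map_sub, key, key]

end

/-! Let `N` be generated by `a` and `c`, and let `χ` be the character of an element `U - V` of
`PO(N)`. Being `𝒫`-matched means that `χ` vanishes on elements of prime power order. The character
induced from index two is zero off `N` and equals `χ(g) + χ(bgb⁻¹)` at `g ∈ N`. As conjugation
preserves orders, induction preserves `PO`.

For injectivity, split `N` in two. An element `a^k c^j` with `c^j ≠ 1` has `q`-th power `1`
(`geom_sum_twistUnit_pow`), so `χ` vanishes there already. A power of `a` is inverted by `b`, and
real characters satisfy `χ(g⁻¹) = χ(g)` (`character_inv_of_real`), so the induced character is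
`2χ(g)` there. If it is zero then `χ = 0`, and real modules with equal characters are isomorphic
(`nonempty_equiv_of_character_eq`).

Uniqueness of `N` holds because a subgroup of index two contains every element of odd order, hence
`a` and `c`. -/

namespace Representation

/-! ### Characters determine representations in characteristic zero -/

section Frobenius

variable {k G V W S : Type*} [Field k] [Group G]
  [AddCommGroup V] [Module k V] [AddCommGroup W] [Module k W] [AddCommGroup S] [Module k S]

theorem character_prod [FiniteDimensional k V] [FiniteDimensional k W]
    (ρ : Representation k G V) (σ : Representation k G W) :
    (ρ.prod σ).character = ρ.character + σ.character := by
  ext g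
  exact LinearMap.trace_prodMap' (ρ g) (σ g)

/-- An injective intertwining map of representations of a finite group splits. -/
theorem exists_equiv_prod_of_injective [Finite G] [NeZero (Nat.card G : k)]
    {τ : Representation k G S} {ρ : Representation k G V}
    (f : τ.IntertwiningMap ρ) (hf : Function.Injective f) :
    ∃ C : Subrepresentation ρ, Nonempty ((τ.prod C.toRepresentation).Equiv ρ) := by
  -- Maschke's theorem: the group order is invertible in `k`, so the image has an invariant
  -- complement.
  obtain ⟨C, hC⟩ := exists_isCompl f.range
  refine ⟨C, ⟨IntertwiningMap.ofBijective
    ⟨f.toLinearMap.coprod C.toSubmodule.subtype, fun g => ?_⟩ ⟨?_, ?_⟩⟩⟩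
  · ext x
    · simpa using f.isIntertwining _ _ g x
    · simp [Subrepresentation.toRepresentation]
  · rw [injective_iff_map_eq_zero]
    rintro ⟨x, y⟩ hxy
    have hxy' : f x + (y : V) = 0 := hxy
    have hy : (y : V) ∈ f.range ⊓ C := by
      refine ⟨⟨-x, ?_⟩, y.2⟩
      exact (map_neg f x).trans (neg_eq_of_add_eq_zero_right hxy')
    rw [hC.inf_eq_bot] at hy
    have hy0 : (y : V) = 0 := hy
    have hx0 : f x = 0 := by simpa [hy0] using hxy'
    exact Prod.ext ((injective_iff_map_eq_zero f).1 hf x hx0) (Subtype.ext hy0)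
  · intro v
    have hv : v ∈ f.range ⊔ C := by rw [hC.sup_eq_top]; exact Submodule.mem_top (R := k)
    have hv' : v ∈ f.range.toSubmodule ⊔ C.toSubmodule := hv
    obtain ⟨_, ⟨x, rfl⟩, y, hy, rfl⟩ := Submodule.mem_sup.1 hv'
    exact ⟨(x, ⟨y, hy⟩), rfl⟩

/-- A nonzero finite-dimensional representation has a nonzero subrepresentation all of whose
nonzero intertwining maps are injective. -/
theorem exists_subrepresentation_injective_of_ne_zero [FiniteDimensional k V] [Nontrivial V]
    (ρ : Representation k G V) :
    ∃ S : Subrepresentation ρ, S ≠ ⊥ ∧ ∀ (σ : Representation k G W)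
      (f : S.toRepresentation.IntertwiningMap σ), f ≠ 0 → Function.Injective f := by
  have hne : ∃ S : Subrepresentation ρ, S ≠ ⊥ := ⟨⊤, fun h => by
    obtain ⟨x, hx⟩ := exists_ne (0 : V)
    have : x ∈ (⊤ : Subrepresentation ρ) := Submodule.mem_top (R := k)
    rw [h] at this
    exact hx this⟩
  -- Take `S` nonzero of least dimension. The kernel of a nonzero `f` is a proper subrepresentation
  -- of `S`, hence zero.
  let m : Subrepresentation ρ → ℕ := fun S => Module.finrank k S.toSubmodule
  obtain ⟨S, hS, hmin⟩ := (measure m).wf.has_min {S | S ≠ ⊥} hne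
  refine ⟨S, hS, fun σ f hf => ?_⟩
  let K : Subrepresentation ρ :=
    { toSubmodule := f.ker.toSubmodule.map S.toSubmodule.subtype
      apply_mem_toSubmodule := by
        rintro g _ ⟨x, hx, rfl⟩
        exact ⟨S.toRepresentation g x, f.ker.apply_mem_toSubmodule g hx, rfl⟩ }
  have hKS : K.toSubmodule ≤ S.toSubmodule := by
    rintro _ ⟨x, -, rfl⟩
    exact x.2
  have hK : K = ⊥ := by
    by_contra hK
    have hlt : K.toSubmodule < S.toSubmodule := by
      refine lt_of_le_of_ne hKS fun h => hf ?_
      apply IntertwiningMap.ext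
      ext x
      have hx : (x : V) ∈ K.toSubmodule := by rw [h]; exact x.2
      obtain ⟨y, hy, hyx⟩ := hx
      obtain rfl : y = x := Subtype.ext hyx
      exact hy
    exact hmin K hK (Submodule.finrank_lt_finrank_of_lt hlt)
  rw [injective_iff_map_eq_zero]
  intro x hx
  have hxK : (x : V) ∈ K := ⟨x, hx, rfl⟩
  rw [hK] at hxK
  exact Subtype.ext hxK

open Module in
/-- Two finite-dimensional representations of a finite group over a field of characteristic zero
with the same character are isomorphic. -/
theorem nonempty_equiv_of_character_eq {k G : Type*} [Field k] [CharZero k] [Group G] [Finite G]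
    {V W : Type*} [AddCommGroup V] [Module k V] [FiniteDimensional k V]
    [AddCommGroup W] [Module k W] [FiniteDimensional k W]
    (ρ : Representation k G V) (σ : Representation k G W) (h : ρ.character = σ.character) :
    Nonempty (ρ.Equiv σ) := by
  have : NeZero (Nat.card G : k) := ⟨Nat.cast_ne_zero.2 Nat.card_pos.ne'⟩
  let : Invertible (Nat.card G : k) := invertibleOfNonzero (NeZero.ne _)
  let : Fintype G := Fintype.ofFinite G
  -- Induction on dimension: find a nonzero piece `S` common to both sides, split it off, and
  -- compare the complements.
  induction hn : finrank k V using Nat.strong_induction_on generalizing V W with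
  | _ n ih =>
  have hdim : finrank k V = finrank k W := by
    have := congr_fun h 1
    simpa using this
  rcases subsingleton_or_nontrivial V with hV | hV
  · have hW : Subsingleton W := by
      rw [← finrank_zero_iff (R := k), ← hdim, finrank_zero_iff]
      exact hV
    exact ⟨IntertwiningMap.ofBijective (0 : ρ.IntertwiningMap σ)
      ⟨fun _ _ _ => Subsingleton.elim _ _, fun _ => ⟨0, Subsingleton.elim _ _⟩⟩⟩
  obtain ⟨S, hS, hinj⟩ := exists_subrepresentation_injective_of_ne_zero (W := W) ρ
  let ι : S.toRepresentation.IntertwiningMap ρ := ⟨S.toSubmodule.subtype, fun _ => rfl⟩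
  have hSnt : Nontrivial S.toSubmodule := by
    rw [Submodule.nontrivial_iff_ne_bot]
    exact fun h0 => hS (Subrepresentation.toSubmodule_injective h0)
  have hι : ι ≠ 0 := fun h0 => by
    obtain ⟨x, hx⟩ := exists_ne (0 : S.toSubmodule)
    exact hx (Subtype.ext (DFunLike.congr_fun h0 x))
  -- The dimension of `Hom(S, ρ)` is an average of products of character values, so it depends on
  -- `ρ` only through its character. The inclusion of `S` makes it positive, which gives a nonzero
  -- map from `S` to `σ`.
  have hrank : finrank k (S.toRepresentation.IntertwiningMap ρ) =
      finrank k (S.toRepresentation.IntertwiningMap σ) := by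
    have h1 := card_inv_mul_sum_char_mul_char_eq_finrank S.toRepresentation ρ
    rw [h, card_inv_mul_sum_char_mul_char_eq_finrank S.toRepresentation σ] at h1
    exact_mod_cast h1.symm
  obtain ⟨f, hf⟩ : ∃ f : S.toRepresentation.IntertwiningMap σ, f ≠ 0 := by
    have : FiniteDimensional k (S.toRepresentation.IntertwiningMap ρ) :=
      .of_injective (invariantsEquivIntertwiningMap S.toRepresentation ρ).symm.toLinearMap
        (LinearEquiv.injective _)
    have hpos : 0 < finrank k (S.toRepresentation.IntertwiningMap ρ) :=
      finrank_pos_iff.2 ⟨ι, 0, hι⟩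
    rw [hrank] at hpos
    have := nontrivial_of_finrank_pos hpos
    exact exists_ne 0
  obtain ⟨C, ⟨eC⟩⟩ := exists_equiv_prod_of_injective ι Subtype.val_injective
  obtain ⟨D, ⟨eD⟩⟩ := exists_equiv_prod_of_injective f (hinj σ f hf)
  have hchar : C.toRepresentation.character = D.toRepresentation.character := by
    have := (char_iso eC).trans (h.trans (char_iso eD).symm)
    rwa [character_prod, character_prod, add_right_inj] at this
  have hlt : finrank k C.toSubmodule < n := by
    have h1 := eC.toLinearEquiv.finrank_eq
    rw [finrank_prod] at h1
    have h2 : 0 < finrank k S.toSubmodule := finrank_pos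
    omega
  obtain ⟨e⟩ := ih _ hlt C.toRepresentation D.toRepresentation hchar rfl
  refine ⟨eC.symm.trans (Equiv.trans (.mk ((LinearEquiv.refl k _).prodCongr e.toLinearEquiv)
    fun g => ?_) eD)⟩
  apply LinearMap.ext
  rintro ⟨x, y⟩
  exact Prod.ext rfl (LinearMap.congr_fun (e.isIntertwining' g) y)

end Frobenius

/-- The character of a real representation of a finite group is invariant under inversion. -/
theorem character_inv_of_real {G V : Type*} [Group G] [Finite G] [AddCommGroup V] [Module ℝ V]
    [FiniteDimensional ℝ V] (ρ : Representation ℝ G V) (g : G) :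
    ρ.character g⁻¹ = ρ.character g := by
  classical
  let : Fintype G := Fintype.ofFinite G
  let b := Module.finBasis ℝ V
  let A : G → Matrix (Fin (Module.finrank ℝ V)) (Fin (Module.finrank ℝ V)) ℝ :=
    fun x => LinearMap.toMatrix b b (ρ x)
  have hmul (x y : G) : A (x * y) = A x * A y := by
    simp only [A, map_mul]
    exact LinearMap.toMatrix_mul b _ _
  have hone : A 1 = 1 := by simp [A, Module.End.one_eq_id]
  have htr (x : G) : ρ.character x = (A x).trace :=
    LinearMap.trace_eq_matrix_trace ℝ b (ρ x)
  -- `P` is the Gram matrix of an invariant inner product. Invariance gives `A g⁻¹ = P⁻¹ (A g)ᵀ P`,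
  -- which has the same trace as `A g`.
  let P := ∑ x : G, (A x).transpose * A x
  have hP : P.PosDef := by
    have hpos (x : G) : ((A x).transpose * A x).PosSemidef := by
      simpa using Matrix.posSemidef_conjTranspose_mul_self (A x)
    -- The term at `x = 1` is the identity matrix, so positive semidefiniteness of the others
    -- suffices.
    rw [show P = 1 + ∑ x ∈ Finset.univ.erase (1 : G), (A x).transpose * A x by
      simp only [P]
      rw [← Finset.add_sum_erase _ _ (Finset.mem_univ (1 : G)), hone]; simp]
    exact Matrix.PosDef.one.add_posSemidef (Matrix.posSemidef_sum _ fun x _ => hpos x)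
  have hinv : (A g).transpose * P * A g = P := by
    simp only [P, Finset.mul_sum, Finset.sum_mul]
    refine Fintype.sum_bijective (· * g) (Group.mulRight_bijective g) _ _ fun x => ?_
    simp only [hmul, Matrix.transpose_mul, Matrix.mul_assoc]
  have hdet : IsUnit P.det := hP.det_pos.ne'.isUnit
  have hA : A g⁻¹ = P⁻¹ * ((A g).transpose * P) := by
    calc A g⁻¹ = P⁻¹ * P * A g⁻¹ := by rw [Matrix.nonsing_inv_mul _ hdet, one_mul]
      _ = P⁻¹ * ((A g).transpose * P * A g) * A g⁻¹ := by rw [hinv]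
      _ = P⁻¹ * ((A g).transpose * P) * (A g * A g⁻¹) := by simp only [Matrix.mul_assoc]
      _ = _ := by rw [← hmul, mul_inv_cancel, hone, mul_one]
  rw [htr, htr, hA, Matrix.trace_mul_comm, Matrix.mul_assoc, Matrix.mul_nonsing_inv _ hdet,
    Matrix.mul_one, Matrix.trace_transpose]

end Representation

namespace Representation

/-! ### The character induced from a subgroup of index two -/

section IndexTwo

variable {G V : Type} [Group G] {N : Subgroup G} [AddCommGroup V] [Module ℝ V]
  (ρ : Representation ℝ N V)

theorem ind_mk_mul (n : N) (k : G) (a : V) :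
    IndV.mk N.subtype ρ (n * k) (ρ n a) = IndV.mk N.subtype ρ k a := by
  refine (Coinvariants.mk_eq_iff _).2 (Coinvariants.mem_ker_of_eq n (.single k 1 ⊗ₜ a) _ ?_)
  simp

theorem ind_mk_mul_left (n : N) (k : G) (a : V) :
    IndV.mk N.subtype ρ (n * k) a = IndV.mk N.subtype ρ k (ρ n⁻¹ a) := by
  rw [← ind_mk_mul ρ n k, ← Module.End.mul_apply, ← map_mul, mul_inv_cancel, map_one,
    Module.End.one_apply]

open Classical in
/-- The coordinates of an induced module with respect to the cosets of `1` and `b`, where `b` lies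
outside the subgroup `N` of index two. -/
noncomputable def indPair (hN : N.index = 2) (b : G) (hb : b ∉ N) :
    IndV N.subtype ρ →ₗ[ℝ] V × V :=
  have hmem (k : G) (hk : k ∉ N) : k * b⁻¹ ∈ N := by
    rw [Subgroup.mul_mem_iff_of_index_two hN, N.inv_mem_iff]; tauto
  Coinvariants.lift _
    -- The formula is forced by the coinvariance relation: write `k` as `k · 1` or as `(k b⁻¹) · b`,
    -- and move the factor in `N` onto the vector, where it acts by its inverse.
    (TensorProduct.lift ((Finsupp.lift _ _ _ fun k : G =>
      if hk : k ∈ N then LinearMap.inl ℝ V V ∘ₗ ρ ⟨k, hk⟩⁻¹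
      else LinearMap.inr ℝ V V ∘ₗ ρ ⟨k * b⁻¹, hmem k hk⟩⁻¹) ∘ₗ
        (MonoidAlgebra.coeffLinearEquiv ℝ).toLinearMap))
    fun n => by
      refine TensorProduct.ext (MonoidAlgebra.lhom_ext' fun k => LinearMap.ext_ring ?_)
      ext1 a
      by_cases hk : k ∈ N
      · have hnk : (n : G) * k ∈ N := N.mul_mem n.2 hk
        have : (⟨n * k, hnk⟩ : N)⁻¹ = ⟨k, hk⟩⁻¹ * n⁻¹ := Subtype.ext (mul_inv_rev _ _)
        simp [hk, hnk, this]
      · have hnk : (n : G) * k ∉ N := fun h => hk ((N.mul_mem_cancel_left n.2).1 h)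
        have : (⟨n * k * b⁻¹, hmem _ hnk⟩ : N)⁻¹ = ⟨k * b⁻¹, hmem _ hk⟩⁻¹ * n⁻¹ :=
          Subtype.ext (by simp [mul_assoc])
        simp [hk, hnk, this]

variable (hN : N.index = 2) (b : G) (hb : b ∉ N)

theorem indPair_mk_one (a : V) : indPair ρ hN b hb (IndV.mk N.subtype ρ 1 a) = (a, 0) := by
  have : (⟨1, N.one_mem⟩ : N) = 1 := rfl
  simp [indPair, N.one_mem, this]

theorem indPair_mk_right (a : V) : indPair ρ hN b hb (IndV.mk N.subtype ρ b a) = (0, a) := by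
  have : (⟨1, N.one_mem⟩ : N) = 1 := rfl
  simp [indPair, hb, this]

/-- The module induced from a subgroup of index two as a direct sum of two copies. -/
noncomputable def indPairEquiv : IndV N.subtype ρ ≃ₗ[ℝ] V × V :=
  .ofLinearMap (indPair ρ hN b hb) ((IndV.mk N.subtype ρ 1).coprod (IndV.mk N.subtype ρ b))
    (by
      apply LinearMap.ext
      rintro ⟨x, y⟩
      rw [LinearMap.comp_apply, LinearMap.coprod_apply, map_add, indPair_mk_one, indPair_mk_right]
      simp)
    (by
      refine IndV.hom_ext _ _ fun k => LinearMap.ext fun a => ?_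
      simp only [LinearMap.comp_apply (f := LinearMap.comp _ _),
        LinearMap.comp_apply (f := LinearMap.id), LinearMap.id_apply]
      by_cases hk : k ∈ N
      · rw [← mul_one k, ind_mk_mul_left ρ ⟨k, hk⟩ 1 a, LinearMap.comp_apply, indPair_mk_one]
        simp
      · have hkb : k * b⁻¹ ∈ N := by
          rw [Subgroup.mul_mem_iff_of_index_two hN, N.inv_mem_iff]; tauto
        rw [← inv_mul_cancel_right k b, ind_mk_mul_left ρ ⟨_, hkb⟩ b a, LinearMap.comp_apply,
          indPair_mk_right]
        simp)

theorem indPairEquiv_symm_apply (x y : V) : (indPairEquiv ρ hN b hb).symm (x, y) =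
    IndV.mk N.subtype ρ 1 x + IndV.mk N.subtype ρ b y := rfl

theorem indPairEquiv_mk_one (a : V) :
    indPairEquiv ρ hN b hb (IndV.mk N.subtype ρ 1 a) = (a, 0) := indPair_mk_one ρ hN b hb a

theorem indPairEquiv_mk_right (a : V) :
    indPairEquiv ρ hN b hb (IndV.mk N.subtype ρ b a) = (0, a) := indPair_mk_right ρ hN b hb a

theorem conj_mem_of_index_two (hN : N.index = 2) (b : G) (g : N) : b * g * b⁻¹ ∈ N :=
  (Subgroup.normal_of_index_eq_two hN).conj_mem g g.2 b

/-- An element of the normal subgroup `N` preserves both cosets, so in the coordinates of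
`indPairEquiv` it acts block diagonally, by `ρ g` and `ρ (b g b⁻¹)`. -/
theorem character_ind_of_mem [FiniteDimensional ℝ V] (hb : b ∉ N) (g : N) :
    (ind N.subtype ρ).character g =
      ρ.character g + ρ.character ⟨b * g * b⁻¹, conj_mem_of_index_two hN b g⟩ := by
  rw [character, ← LinearMap.trace_conj' _ (indPairEquiv ρ hN b hb), character, character,
    ← LinearMap.trace_prodMap']
  congr 1
  apply LinearMap.ext
  rintro ⟨x, y⟩
  rw [LinearEquiv.conj_apply_apply, indPairEquiv_symm_apply, map_add, ind_mk, ind_mk, map_add,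
    show (1 : G) * (g : G)⁻¹ = (g⁻¹ : N) * 1 by simp,
    show b * (g : G)⁻¹ = (⟨b * g * b⁻¹, conj_mem_of_index_two hN b g⟩⁻¹ : N) * b by
      simp [mul_assoc],
    ind_mk_mul_left, ind_mk_mul_left, indPairEquiv_mk_one, indPairEquiv_mk_right]
  simp

/-- With `g` itself as representative of the nontrivial coset, `g` exchanges the two copies of `V`:
one block is `ρ (g²)`, the other the identity, and both are off the diagonal. -/
theorem character_ind_of_notMem [FiniteDimensional ℝ V] (hN : N.index = 2) (g : G) (hg : g ∉ N) :
    (ind N.subtype ρ).character g = 0 := by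
  -- The element `g * g⁻¹⁻¹` is `g²`.
  have hgg : g * g⁻¹⁻¹ ∈ N := by simpa [← sq] using Subgroup.sq_mem_of_index_two hN g
  have hT : (indPairEquiv ρ hN g hg).conj (ind N.subtype ρ g) =
      LinearMap.inr ℝ V V ∘ₗ (ρ ⟨g * g⁻¹⁻¹, hgg⟩ ∘ₗ LinearMap.fst ℝ V V) +
        LinearMap.inl ℝ V V ∘ₗ LinearMap.snd ℝ V V := by
    apply LinearMap.ext
    rintro ⟨x, y⟩
    rw [LinearEquiv.conj_apply_apply, indPairEquiv_symm_apply, map_add, ind_mk, ind_mk, map_add,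
      show (1 : G) * g⁻¹ = (⟨g * g⁻¹⁻¹, hgg⟩⁻¹ : N) * g by simp [mul_assoc], mul_inv_cancel,
      ind_mk_mul_left, indPairEquiv_mk_one, indPairEquiv_mk_right]
    simp
  rw [character, ← LinearMap.trace_conj' _ (indPairEquiv ρ hN g hg), hT, map_add,
    LinearMap.trace_comp_comm', LinearMap.trace_comp_comm' (LinearMap.snd ℝ V V),
    LinearMap.comp_assoc, LinearMap.fst_comp_inr, LinearMap.snd_comp_inl]
  simp

end IndexTwo

end Representation

/-! ### Characters on `RO(G)` and the matching condition -/

namespace RealRep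

variable {G : Type} [Group G]

theorem character_eq_of_iso {U V : RealRep G} (h : Iso U V) : U.ρ.character = V.ρ.character :=
  h.elim fun e => Representation.char_iso e

theorem iso_of_character_eq [Finite G] {U V : RealRep G} (h : U.ρ.character = V.ρ.character) :
    Iso U V :=
  Representation.nonempty_equiv_of_character_eq U.ρ V.ρ h

theorem cls_eq_of_iso {U V : RealRep G} (h : Iso U V) : U.cls = V.cls :=
  congrArg Algebra.GrothendieckAddGroup.of (Quotient.sound h : RepClass.mk U = RepClass.mk V)

theorem character_sum (U V : RealRep G) :
    (sum U V).ρ.character = U.ρ.character + V.ρ.character :=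
  Representation.character_prod U.ρ V.ρ

/-- The value at `g` of the character of an isomorphism class of real modules. -/
noncomputable def charClass (g : G) : RepClass G →+ ℝ where
  toFun := Quotient.lift (fun U : RealRep G => U.ρ.character g) fun _ _ h =>
    congr_fun (character_eq_of_iso h) g
  map_zero' := by
    change LinearMap.trace ℝ PUnit _ = 0
    rw [show (zero G).ρ g = (0 : PUnit →ₗ[ℝ] PUnit) from
      LinearMap.ext fun _ => Subsingleton.elim (α := PUnit) _ _]
    exact map_zero (LinearMap.trace ℝ PUnit)
  map_add' := by
    rintro ⟨U⟩ ⟨V⟩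
    exact congr_fun (character_sum U V) g

/-- The value at `g` of the character of an element of `RO(G)`. -/
noncomputable def charRO (g : G) : RO G →+ ℝ := Algebra.GrothendieckAddGroup.lift (charClass g)

theorem charRO_cls (g : G) (U : RealRep G) : charRO g U.cls = U.ρ.character g :=
  DFunLike.congr_fun (Algebra.GrothendieckAddGroup.lift.symm_apply_apply (charClass g))
    (RepClass.mk U)

/-- Two real modules are `𝒫`-matched if and only if their characters agree on the elements of
prime power order. -/
theorem pMatched_iff_character [Finite G] {U V : RealRep G} :
    PMatched U V ↔ ∀ (g : G) (l k : ℕ), l.Prime → orderOf g = l ^ k →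
      U.ρ.character g = V.ρ.character g := by
  constructor
  · intro h g l k hl hg
    have := h (Subgroup.zpowers g) ⟨l, k, hl, by rw [Nat.card_zpowers, hg]⟩
    exact congr_fun (character_eq_of_iso this) ⟨g, Subgroup.mem_zpowers g⟩
  · rintro h P ⟨l, k, hl, hP⟩
    refine iso_of_character_eq (funext fun x => ?_)
    have hx : orderOf (x : G) ∣ l ^ k := by
      rw [Subgroup.orderOf_coe, ← hP]
      exact orderOf_dvd_natCard x
    obtain ⟨j, -, hj⟩ := (Nat.dvd_prime_pow hl).1 hx
    exact h x l j hl hj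

/-- Induction from a subgroup of index two preserves `𝒫`-matched pairs. -/
theorem PMatched.ind_of_index_two [Finite G] {N : Subgroup G} (hN : N.index = 2)
    {U V : RealRep N} (h : PMatched U V) : PMatched (ind N U) (ind N V) := by
  rw [pMatched_iff_character] at h ⊢
  intro g l k hl hg
  by_cases hgN : g ∈ N
  · obtain ⟨b, hb⟩ : ∃ b : G, b ∉ N := by
      by_contra! hall
      rw [(Subgroup.eq_top_iff' N).2 hall, Subgroup.index_top] at hN
      omega
    lift g to N using hgN
    have hg' : orderOf g = l ^ k := by rw [← hg, Subgroup.orderOf_coe]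
    refine (Representation.character_ind_of_mem U.ρ hN b hb g).trans
      (.trans ?_ (Representation.character_ind_of_mem V.ρ hN b hb g).symm)
    -- Both summands of the induced character are values at elements of the same prime power order.
    rw [h g l k hl hg', h _ l k hl]
    rw [← Subgroup.orderOf_coe, ← hg]
    exact (MulAut.conj b).orderOf_eq (g : G)
  · exact (Representation.character_ind_of_notMem U.ρ hN g hgN).trans
      (Representation.character_ind_of_notMem V.ρ hN g hgN).symm

end RealRep

/-! ### Induction on `PO(N)` from index two -/

theorem indRO_mem_PO_of_index_two {G : Type} [Group G] [Finite G] {N : Subgroup G}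
    (hN : N.index = 2) {x : RO N} (hx : x ∈ PO N) : indRO N x ∈ PO G := by
  obtain ⟨U, V, h, rfl⟩ := hx
  exact ⟨U.ind N, V.ind N, h.ind_of_index_two hN, indRO_cls N U V⟩

/-- If an element outside the index two subgroup `N` inverts every element of `N` which is not of
prime power order, then induction from `N` is injective on `PO(N)`. -/
theorem eq_zero_of_indRO_eq_zero {G : Type} [Group G] [Finite G] {N : Subgroup G}
    (hN : N.index = 2) {b : G} (hb : b ∉ N)
    (hinv : ∀ g ∈ N, (∃ l k : ℕ, l.Prime ∧ orderOf g = l ^ k) ∨ b * g * b⁻¹ = g⁻¹)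
    {x : RO N} (hx : x ∈ PO N) (h0 : indRO N x = 0) : x = 0 := by
  obtain ⟨U, V, h, rfl⟩ := hx
  rw [indRO_cls] at h0
  rw [sub_eq_zero]
  refine RealRep.cls_eq_of_iso (RealRep.iso_of_character_eq (funext fun g => ?_))
  rcases hinv g g.2 with ⟨l, k, hl, hg⟩ | hg
  · exact RealRep.pMatched_iff_character.1 h g l k hl (by rw [← hg, Subgroup.orderOf_coe])
  -- Equality in `RO(G)` gives an isomorphism only after adding some `W`; since `charRO` is defined
  -- on `RO(G)`, the characters still agree.
  · have h1 := congrArg (RealRep.charRO (g : G)) h0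
    rw [map_sub, map_zero, RealRep.charRO_cls, RealRep.charRO_cls, sub_eq_zero] at h1
    have h2 := (Representation.character_ind_of_mem U.ρ hN b hb g).symm.trans
      (h1.trans (Representation.character_ind_of_mem V.ρ hN b hb g))
    have hconj : (⟨b * g * b⁻¹, Representation.conj_mem_of_index_two hN b g⟩ : N) = g⁻¹ :=
      Subtype.ext hg
    rw [hconj, Representation.character_inv_of_real, Representation.character_inv_of_real] at h2
    linarith

/-- If `m = 2j + 1` then `g = (g^(j+1))²`, and squares lie in a subgroup of index two. -/
theorem mem_of_index_two_of_pow_eq_one {G : Type*} [Group G] {N : Subgroup G} (hN : N.index = 2)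
    {g : G} {m : ℕ} (hm : Odd m) (hg : g ^ m = 1) : g ∈ N := by
  obtain ⟨j, rfl⟩ := hm
  have := Subgroup.sq_mem_of_index_two hN (g ^ (j + 1))
  rwa [← pow_mul, show (j + 1) * 2 = 2 * j + 1 + 1 by ring, pow_succ, hg, one_mul] at this

/-! ### Rotations and index two subgroups in `D_{2n} ⋊ K` -/

namespace DihedralGroup

variable {n : ℕ} {K : Type} [Group K] {φ : K →* MulAut (DihedralGroup n)}

theorem scale_r (u : (ZMod n)ˣ) (k : ZMod n) : scale u (r k) = r ((u : ZMod n) * k) := rfl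

theorem scale_sr (u : (ZMod n)ˣ) (k : ZMod n) : scale u (sr k) = sr ((u : ZMod n) * k) := rfl

/-- Moving each factor `z` to the right past the rotations multiplies their exponents by `w`, so a
geometric sum accumulates. -/
theorem semidirect_r_pow {z : K} {w : (ZMod n)ˣ} (hw : φ z = scale w) (k : ZMod n) (m : ℕ) :
    (⟨r k, z⟩ : DihedralGroup n ⋊[φ] K) ^ m = ⟨r ((∑ t ∈ Finset.range m, (w : ZMod n) ^ t) * k),
      z ^ m⟩ := by
  induction m with
  | zero => simp
  | succ m ih =>
    rw [pow_succ', ih, geom_sum_succ]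
    refine SemidirectProduct.ext ?_ (pow_succ' z m).symm
    simp only [SemidirectProduct.mul_left, hw, scale_r, r_mul_r]
    congr 1
    ring

/-- The elements of `D_{2n} ⋊ K` whose dihedral component is a rotation. -/
def semidirectRotations (hφ : ∀ z, ∃ w, φ z = scale w) : Subgroup (DihedralGroup n ⋊[φ] K) where
  carrier := {x | ∃ k, x.left = r k}
  one_mem' := ⟨0, rfl⟩
  mul_mem' := by
    rintro ⟨_, z⟩ ⟨_, z'⟩ ⟨k, rfl⟩ ⟨k', rfl⟩
    obtain ⟨w, hw⟩ := hφ z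
    exact ⟨k + w * k', by simp [hw, scale_r]⟩
  inv_mem' := by
    rintro ⟨_, z⟩ ⟨k, rfl⟩
    obtain ⟨w, hw⟩ := hφ z⁻¹
    exact ⟨w * -k, by rw [SemidirectProduct.inv_left, inv_r, hw, scale_r]⟩

theorem index_semidirectRotations (hφ : ∀ z, ∃ w, φ z = scale w) :
    (semidirectRotations hφ).index = 2 := by
  rw [Subgroup.index_eq_two_iff]
  -- Right multiplication by `b = sr 0`, which every `scale` fixes, interchanges rotations and
  -- reflections.
  refine ⟨SemidirectProduct.inl (sr 0), ?_⟩
  rintro ⟨x, z⟩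
  obtain ⟨w, hw⟩ := hφ z
  rcases x with k | k <;>
    simp [semidirectRotations, Subgroup.mem_mk, hw, scale_sr, SemidirectProduct.mul_left]

/-- Rotations and elements of `K` have odd order, so `N` contains the subgroup they generate; as
both have index two, they coincide. -/
theorem eq_semidirectRotations (hφ : ∀ z, ∃ w, φ z = scale w) (hn : Odd n)
    {m : ℕ} (hm : Odd m) (hK : ∀ z : K, z ^ m = 1)
    {N : Subgroup (DihedralGroup n ⋊[φ] K)} (hN : N.index = 2) : N = semidirectRotations hφ := by
  have hle : semidirectRotations hφ ≤ N := by
    rintro ⟨_, z⟩ ⟨k, rfl⟩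
    rw [SemidirectProduct.mk_eq_inl_mul_inr]
    refine N.mul_mem (mem_of_index_two_of_pow_eq_one hN hn ?_)
      (mem_of_index_two_of_pow_eq_one hN hm ?_)
    · rw [← map_pow, r_pow]
      simp
    · rw [← map_pow, hK, map_one]
  refine le_antisymm ?_ hle
  have h := Subgroup.relIndex_mul_index hle
  rw [hN, index_semidirectRotations, Nat.mul_eq_right two_ne_zero, Subgroup.relIndex_eq_one] at h
  exact h

end DihedralGroup

/-! ### Arithmetic of the twisting unit -/

section GroupPQ

open DihedralGroup

variable {p q v : ℕ} [Fact p.Prime] [Fact q.Prime]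

theorem cyclicHom_apply {M : Type*} [Group M] (q : ℕ) [NeZero q] (m : M) (hm : m ^ q = 1)
    (z : Multiplicative (ZMod q)) : cyclicHom q m hm z = m ^ z.toAdd.val := by
  have hz : z = Multiplicative.ofAdd (1 : ZMod q) ^ z.toAdd.val := by
    rw [← ofAdd_nsmul, nsmul_one, ZMod.natCast_zmod_val, ofAdd_toAdd]
  conv_lhs => rw [hz, map_pow, cyclicHom_generator]

/-- Modulo `p`, the base is a `q`-th root of unity other than `1`, so the sum vanishes. Modulo `q`,
the base is `1` by Fermat, so the sum is `q = 0`. The primes are distinct, so it vanishes modulo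
`pq`. -/
theorem geom_sum_twistUnit_pow (hqp : q ∣ p - 1) (hv : IsPrimitiveRoot (v : ZMod p) (p - 1))
    (hqv : ¬ q ∣ v) {j : ℕ} (hj : ¬ q ∣ j) :
    ∑ t ∈ Finset.range q, ((twistUnit p q v hv hqv ^ j : (ZMod (p * q))ˣ) : ZMod (p * q)) ^ t =
      0 := by
  have hP : p.Prime := Fact.out
  have hQ : q.Prime := Fact.out
  have hp1 : 0 < p - 1 := by have := hP.two_le; omega
  have hne : p ≠ q := by
    rintro rfl
    exact absurd (Nat.le_of_dvd hp1 hqp) (by omega)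
  have hcast : ((twistUnit p q v hv hqv ^ j : (ZMod (p * q))ˣ) : ZMod (p * q)) =
      (((v ^ ((p - 1) * (q - 1) / q)) ^ j : ℕ) : ZMod (p * q)) := by
    simp [twistUnit]
  obtain ⟨d, hd⟩ := hqp
  have hE : (p - 1) * (q - 1) / q = d * (q - 1) := by
    rw [hd, mul_assoc, Nat.mul_div_cancel_left _ hQ.pos]
  rw [hcast, hE]
  set y := (v ^ (d * (q - 1))) ^ j with hy
  have hyq : (y : ZMod q) = 1 := by
    have hv0 : (v : ZMod q) ≠ 0 := by rwa [Ne, ZMod.natCast_eq_zero_iff]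
    rw [hy]
    push_cast
    rw [mul_comm d, pow_mul, ZMod.pow_card_sub_one_eq_one hv0, one_pow, one_pow]
  -- With `p - 1 = qd`, triviality would require `qd ∣ d(q - 1)j`, hence `q ∣ q - 1` or `q ∣ j`.
  have hyp : (y : ZMod p) ≠ 1 := by
    rw [hy]
    push_cast
    rw [← pow_mul, Ne, hv.pow_eq_one_iff_dvd, hd]
    intro hdvd
    have hd0 : 0 < d := Nat.pos_of_ne_zero (by rintro rfl; omega)
    rw [mul_comm q, mul_assoc] at hdvd
    rcases hQ.dvd_mul.1 (Nat.dvd_of_mul_dvd_mul_left hd0 hdvd) with h | h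
    · exact absurd (Nat.le_of_dvd (by have := hQ.two_le; omega) h) (by have := hQ.two_le; omega)
    · exact hj h
  have hypq : (y : ZMod p) ^ q = 1 := by
    rw [hy]
    push_cast
    rw [← pow_mul, ← pow_mul, hv.pow_eq_one_iff_dvd, hd]
    exact ⟨(q - 1) * j, by ring⟩
  have hsum : (∑ t ∈ Finset.range q, (y : ZMod (p * q)) ^ t) =
      ((∑ t ∈ Finset.range q, y ^ t : ℕ) : ZMod (p * q)) := by push_cast; rfl
  rw [hsum, ZMod.natCast_eq_zero_iff]
  refine ((Nat.coprime_primes hP hQ).2 hne).mul_dvd_of_dvd_of_dvd ?_ ?_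
  · rw [← ZMod.natCast_eq_zero_iff]
    push_cast
    have := mul_geom_sum (y : ZMod p) q
    rw [hypq, sub_self] at this
    exact (mul_eq_zero.1 this).resolve_left (sub_ne_zero.2 hyp)
  · rw [← ZMod.natCast_eq_zero_iff]
    push_cast
    simp [hyq]

end GroupPQ

/-! ### The corollary for `G_{p,q}` -/

theorem mainTheorem6 (p q : ℕ) [Fact p.Prime] [Fact q.Prime] (hp : Odd p) (hq : Odd q)
    (hqp : q ∣ p - 1) (v : ℕ) (hv : IsPrimitiveRoot (v : ZMod p) (p - 1)) (hqv : ¬ q ∣ v) :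
    (∃! N : Subgroup (GroupPQ p q v hqp hv hqv), N.index = 2) ∧
    ∀ N : Subgroup (GroupPQ p q v hqp hv hqv), N.index = 2 →
      ∃ Ind : PO N →+ PO (GroupPQ p q v hqp hv hqv),
        (∀ x : PO N, (Ind x : RO (GroupPQ p q v hqp hv hqv)) = indRO N x) ∧
        Function.Injective Ind := by
  have hact (z : Multiplicative (ZMod q)) :
      cyclicHom q (DihedralGroup.scaleHom (p * q) (twistUnit p q v hv hqv))
        (by rw [← map_pow, twistUnit_pow p q v hqp hv hqv, map_one]) z =
      DihedralGroup.scale (twistUnit p q v hv hqv ^ z.toAdd.val) := by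
    rw [cyclicHom_apply, ← map_pow]
    rfl
  have hK (z : Multiplicative (ZMod q)) : z ^ q = 1 := by
    rw [← ofAdd_toAdd z, ← ofAdd_nsmul]
    simp
  have hφ := fun z => (⟨_, hact z⟩ : ∃ w, _ = DihedralGroup.scale w)
  have huniq (N : Subgroup (GroupPQ p q v hqp hv hqv)) (hN : N.index = 2) :
      N = DihedralGroup.semidirectRotations hφ :=
    DihedralGroup.eq_semidirectRotations hφ (hp.mul hq) hq hK hN
  refine ⟨⟨_, DihedralGroup.index_semidirectRotations hφ, huniq⟩, fun N hN => ?_⟩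
  refine ⟨((indRO N).comp (PO N).subtype).codRestrict (PO _) fun x =>
    indRO_mem_PO_of_index_two hN x.2, fun _ => rfl, ?_⟩
  rw [injective_iff_map_eq_zero]
  intro x hx
  have hb : (SemidirectProduct.inl (DihedralGroup.sr 0) : GroupPQ p q v hqp hv hqv) ∉ N := by
    rw [huniq N hN]
    rintro ⟨k, hk⟩
    cases hk
  refine Subtype.ext (eq_zero_of_indRO_eq_zero hN hb ?_ x.2 (congrArg Subtype.val hx))
  intro g hg
  rw [huniq N hN] at hg
  obtain ⟨x, z⟩ := g
  obtain ⟨k, rfl : x = _⟩ := hg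
  -- Powers of `a` are inverted by `b`; all other elements of `N` have order dividing `q`.
  by_cases hz : z = 1
  · right
    subst hz
    rw [show (⟨DihedralGroup.r k, 1⟩ : GroupPQ p q v hqp hv hqv) =
      SemidirectProduct.inl (DihedralGroup.r k) from rfl, ← map_inv, ← map_inv, ← map_mul,
      ← map_mul]
    simp
  · left
    have hQ : q.Prime := Fact.out
    have hj : ¬ q ∣ z.toAdd.val := fun h => hz <| by
      rw [← ZMod.natCast_eq_zero_iff, ZMod.natCast_zmod_val] at h
      exact h
    have hpow := DihedralGroup.semidirect_r_pow (hact z) k q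
    rw [geom_sum_twistUnit_pow hqp hv hqv hj, zero_mul, hK] at hpow
    -- Order one need not be excluded, since `1 = q ^ 0` counts as a prime power.
    rcases (Nat.dvd_prime hQ).1 (orderOf_dvd_of_pow_eq_one (hpow.trans rfl)) with h | h
    · exact ⟨q, 0, hQ, h.trans (pow_zero q).symm⟩
    · exact ⟨q, 1, hQ, h.trans (pow_one q).symm⟩
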